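/- All graphs are finite, simple and nonempty; $|G|$ is the number of vertices of $G$. For graphs $G$ and $H$, the Ramsey number $R(G,H)$ is the least $N$ such that every red/blue colouring of the edges of the complete graph on $N$ vertices contains a red copy of $G$ or a blue copy of $H$. Let $\chi(H)$ be the chromatic number of $H$, and let $\sigma(H)$ be the minimum size of a colour class in a proper $\chi(H)$-colouring of $H$. Let $P_n^k$ be the $k$th power of the path $P_n$ on $n$ vertices, i.e. the graph on $V(P_n)$ in which two distinct vertices are adjacent if and only if their distance in $P_n$ is at most $k$. The bandwidth $\mathrm{bw}(G)$ of an $n$-vertex graph $G$ is the smallest $k$ such that $G$ is isomorphic to a subgraph of $P_n^k$. A connected graph $G$ is $H$-good if $R(G,H)=(\chi(H)-1)(|G|-1)+\sigma(H)$. A class $\mathcal G$ of graphs is always-good if, for every graph $H$, there is $n_0$ such that every $G\in\mathcal G$ with $|G|\ge n_0$ is connected and $H$-good. **Theorem.** For every graph $H$ and every integer $k\ge 1$, $$R(P_n^k,H)=(\chi(H)-1)(n-1)+\sigma(H)\qquad\text{whenever } n\ge (20k|H|)^{16k|H|}.$$ In particular, if $\kappa:\mathbb N\to\mathbb R$ is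 any function with $\kappa(n)=o(\log n/\log\log n)$ as $n\to\infty$, then the class $\mathcal B_\kappa=\{G : \mathrm{bw}(G)\le\kappa(|G|) \text{ and } G \text{ is connected}\}$ is always-good. -/

import Mathlib

open SimpleGraph Asymptotics Filter

universe u

/-- The `k`-th power `F ^ k` of a graph `F`: distinct vertices are adjacent when their distance in `F`
is at most `k` (the extended distance is infinite between different components). -/
def graphPower {V : Type*} (F : SimpleGraph V) (k : ℕ) : SimpleGraph V where
  Adj u v := u ≠ v ∧ F.edist u v ≤ (k : ℕ∞)
  symm := ⟨fun u v h => ⟨h.1.symm, by rw [SimpleGraph.edist_comm]; exact h.2⟩⟩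
  loopless := ⟨fun u h => h.1 rfl⟩

/-- `P_n ^ k`, the `k`-th power of the path on `n` vertices. -/
def pathPower (n k : ℕ) : SimpleGraph (Fin n) := graphPower (SimpleGraph.pathGraph n) k

/-- The bandwidth of `G`: the smallest `k` such that `G` is (isomorphic to) a subgraph of `P_n ^ k`,
where `n` is the number of vertices of `G`. -/
noncomputable def bandwidth {V : Type*} [Fintype V] (G : SimpleGraph V) : ℕ :=
  sInf {k : ℕ | G.IsContained (pathPower (Fintype.card V) k)}

/-- The Ramsey number `R(G, H)`: the smallest `N` such that every red/blue colouring of the edges of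
the complete graph on `N` vertices has a red copy of `G` or a blue copy of `H`. A colouring is given
by its graph of red edges; the blue edges are those of the complement. -/
noncomputable def ramseyNumber {V W : Type*} (G : SimpleGraph V) (H : SimpleGraph W) : ℕ :=
  sInf {N : ℕ | ∀ red : SimpleGraph (Fin N), G.IsContained red ∨ H.IsContained redᶜ}

/-- The chromatic number as a natural number (it is finite for finite graphs). -/
noncomputable def chi {W : Type*} (H : SimpleGraph W) : ℕ := H.chromaticNumber.toNat

/-- `σ(H)`: the minimum size of a colour class in a proper `χ(H)`-colouring of `H`. -/
noncomputable def sigma {W : Type*} (H : SimpleGraph W) : ℕ :=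
  sInf {m : ℕ | ∃ (C : H.Coloring (Fin (chi H))) (c : Fin (chi H)), m = (C.colorClass c).ncard}

/-- `G` is `H`-good: `G` is connected and `R(G, H) = (χ(H) - 1)(|G| - 1) + σ(H)`. -/
def IsGood {V W : Type*} [Fintype V] (G : SimpleGraph V) (H : SimpleGraph W) : Prop :=
  G.Connected ∧ ramseyNumber G H = (chi H - 1) * (Fintype.card V - 1) + sigma H

/-- A class of finite graphs. -/
abbrev GraphClass : Type (u + 1) := ∀ (V : Type u) [Fintype V], SimpleGraph V → Prop

/-- A class of graphs is `H`-good if all its sufficiently large members are `H`-good. -/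
def GraphClass.IsGood (𝒢 : GraphClass.{u}) {W : Type u} (H : SimpleGraph W) : Prop :=
  ∃ n₀ : ℕ, ∀ (V : Type u) [Fintype V] (G : SimpleGraph V),
    𝒢 V G → n₀ ≤ Fintype.card V → _root_.IsGood G H

/-- A class of graphs is always-good if it is `H`-good for every (finite, nonempty) graph `H`. -/
def GraphClass.AlwaysGood (𝒢 : GraphClass.{u}) : Prop :=
  ∀ (W : Type u) [Fintype W] [Nonempty W] (H : SimpleGraph W), GraphClass.IsGood 𝒢 H

/-- The class of connected graphs `G` with bandwidth at most `κ(|G|)`. -/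
def boundedBandwidth (κ : ℕ → ℝ) : GraphClass.{u} := fun V _ G =>
  (bandwidth G : ℝ) ≤ κ (Fintype.card V) ∧ G.Connected

/-! Lower bound: split fewer than (χ(H)-1)(n-1)+σ(H) vertices into classes of size at most n-1, the
last one smaller than σ(H), with red inside classes and blue between. A connected red graph stays in
one class, and a blue H would be properly χ(H)-coloured with a class smaller than σ(H)
(`ramsey_lower_bound`).

Upper bound (`pathPower_or_isContained`): suppose there is neither a red path power nor a blue H,
and write h = |H|. A Ramsey argument packs all but a bounded set of vertices into disjoint red
cliques of one constant size. A leftover vertex with 3k red neighbours in a clique can be absorbed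
there, one vertex per clique; absorption is done maximally. Two cliques are linked if a red K_{k,k}
between them survives any 3k deletions. A chain of linked cliques carries a red k-th path power
through all its vertices, absorbed ones included (`pathPower_isContained_of_chain`), so each chain
has at most n-1 vertices. Pairwise unlinked cliques contain h-sets with only blue edges between
different sets (`exists_independent_family_of_not_linked`).

Cover the cliques by chains with pairwise unlinked heads. With χ(H) chains the heads would give a
blue H, so there are at most χ(H)-1. Counting then forces exactly χ(H)-1 chains, each nearly full,
and at least σ(H) unabsorbed vertices. Trim each chain until it starts with a clique that absorbed
nothing. The new heads are still pairwise unlinked, since gluing two nearly full chains would give a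
red path power that is too long. By maximality each unabsorbed vertex has fewer than 3k red
neighbours in each new head. So σ(H) such vertices, with h-sets taken from the heads away from their
neighbours, form a blue complete multipartite graph containing H. -/

/-! ### Path powers as vertex lists -/

section PowerLists

variable {V : Type*}

/-- `l` lists vertices so that any two at distance at most `k` in the list are adjacent. -/
def IsPowerList (R : SimpleGraph V) (k : ℕ) : List V → Prop
  | [] => True
  | x :: l => (∀ y ∈ l.take k, R.Adj x y) ∧ IsPowerList R k l

theorem isPowerList_of_pairwise {R : SimpleGraph V} {k : ℕ} {l : List V}
    (h : l.Pairwise R.Adj) : IsPowerList R k l := by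
  induction l with
  | nil => trivial
  | cons x l ih =>
    rw [List.pairwise_cons] at h
    exact ⟨fun y hy => h.1 y (List.mem_of_mem_take hy), ih h.2⟩

/-- Every adjacency condition spans at most k places, so none reaches from `l₁` across `m` into
`l₂`. This is the gluing tool for all later constructions. -/
theorem IsPowerList.append_overlap {R : SimpleGraph V} {k : ℕ} {l₁ m l₂ : List V}
    (h₁ : IsPowerList R k (l₁ ++ m)) (h₂ : IsPowerList R k (m ++ l₂)) (hm : k ≤ m.length) :
    IsPowerList R k (l₁ ++ m ++ l₂) := by
  induction l₁ with
  | nil => simpa using h₂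
  | cons x l ih =>
    refine ⟨fun y hy => h₁.1 y ?_, ih h₁.2⟩
    have : (l ++ m ++ l₂).take k = (l ++ m).take k := by
      rw [List.take_append_of_le_length]
      simp; omega
    change y ∈ (l ++ m).take k
    rwa [← this]

theorem IsPowerList.adj {R : SimpleGraph V} {k : ℕ} {l : List V} (h : IsPowerList R k l)
    {i j : ℕ} (hi : i < l.length) (hj : j < l.length) (hij : i < j) (hk : j ≤ i + k) :
    R.Adj l[i] l[j] := by
  induction l generalizing i j with
  | nil => simp at hi
  | cons x l ih =>
    obtain ⟨j, rfl⟩ : ∃ j', j = j' + 1 := ⟨j - 1, by omega⟩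
    cases i with
    | zero =>
      refine h.1 _ ?_
      rw [List.mem_take_iff_getElem]
      refine ⟨j, ?_, by simp⟩
      simp at hj
      omega
    | succ i =>
      simp only [List.getElem_cons_succ]
      exact ih h.2 (by simpa using hi) (by simpa using hj) (by omega) (by omega)

theorem pathGraph_le_add_length {n : ℕ} {i j : Fin n} (p : (pathGraph n).Walk i j) :
    (j : ℕ) ≤ i + p.length := by
  induction p with
  | nil => simp
  | cons h p ih =>
    rw [pathGraph_adj] at h
    simp only [Walk.length_cons]
    omega

theorem pathPower_adj_le {n k : ℕ} {i j : Fin n} (h : (pathPower n k).Adj i j) :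
    (j : ℕ) ≤ i + k := by
  have h2 : (pathGraph n).edist i j ≤ k := h.2
  obtain ⟨p, hp⟩ := exists_walk_of_edist_ne_top (G := pathGraph n) (u := i) (v := j)
    (ne_top_of_le_ne_top (by simp) h2)
  have h3 := pathGraph_le_add_length p
  rw [← hp] at h2
  have : p.length ≤ k := by exact_mod_cast h2
  omega

theorem IsPowerList.pathPower_isContained {R : SimpleGraph V} {k n : ℕ} {l : List V}
    (h : IsPowerList R k l) (hl : l.Nodup) (hn : n ≤ l.length) :
    (pathPower n k).IsContained R := by
  refine ⟨⟨⟨fun i => l[i.1]'(i.2.trans_le hn), ?_⟩, ?_⟩⟩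
  · intro i j hij
    rcases lt_trichotomy i j with hlt | rfl | hlt
    · exact h.adj _ _ hlt (pathPower_adj_le hij)
    · exact absurd rfl hij.1
    · exact (h.adj _ _ hlt (pathPower_adj_le hij.symm)).symm
  · intro i j hij
    exact Fin.ext ((hl.getElem_inj_iff).1 hij)

end PowerLists

/-! ### Covering by paths with unrelated heads -/

section PathCover

variable {α : Type*}

/-- A finite set can be covered by disjoint paths of a symmetric relation whose heads are pairwise
unrelated. -/
theorem exists_path_cover (r : α → α → Prop) (hr : ∀ a b, r a b → r b a) (L : List α) :
    ∃ P : List (List α), P.flatten.Perm L ∧ (∀ l ∈ P, l ≠ [] ∧ l.IsChain r) ∧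
      P.Pairwise (fun l m => ∀ x ∈ l.head?, ∀ y ∈ m.head?, ¬ r x y) := by
  have key : ∀ n, ∀ P : List (List α), P.length = n → P.flatten.Perm L →
      (∀ l ∈ P, l ≠ [] ∧ l.IsChain r) → ∃ P : List (List α), P.flatten.Perm L ∧
      (∀ l ∈ P, l ≠ [] ∧ l.IsChain r) ∧
      P.Pairwise (fun l m => ∀ x ∈ l.head?, ∀ y ∈ m.head?, ¬ r x y) := by
    intro n
    induction n with
    | zero =>
      intro P hP hL hc
      obtain rfl := List.length_eq_zero_iff.1 hP
      exact ⟨[], hL, hc, List.Pairwise.nil⟩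
    | succ n ih =>
      intro P hP hL hc
      by_cases hpw : P.Pairwise (fun l m => ∀ x ∈ l.head?, ∀ y ∈ m.head?, ¬ r x y)
      · exact ⟨P, hL, hc, hpw⟩
      rw [List.pairwise_iff_forall_sublist] at hpw
      push Not at hpw
      obtain ⟨a, b, hab, x, hx, y, hy, hxy⟩ := hpw
      obtain ⟨Q, hQ⟩ := hab.exists_perm_append
      have hQ' : P.Perm (a :: b :: Q) := by simpa using hQ
      have ha := hc a (hQ'.mem_iff.2 (by simp))
      have hb := hc b (hQ'.mem_iff.2 (by simp))
      -- Two related heads are joined by reversing one path, which lowers the number of paths by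
      -- one.
      refine ih ((a.reverse ++ b) :: Q) ?_ ?_ ?_
      · have := hQ'.length_eq
        simp at this ⊢
        omega
      · refine List.Perm.trans ?_ (hQ'.flatten.symm.trans hL)
        simp only [List.flatten_cons, List.append_assoc]
        exact (List.reverse_perm a).append_right _
      · intro l hl
        rcases List.mem_cons.1 hl with rfl | hl
        · refine ⟨by simp [ha.1], List.IsChain.append ?_ hb.2 ?_⟩
          · rw [List.isChain_reverse]
            exact ha.2.imp fun _ _ h => hr _ _ h
          · intro u hu v hv
            rw [List.getLast?_reverse] at hu
            rw [Option.mem_unique hu hx, Option.mem_unique hv hy]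
            exact hxy
        · exact hc l (hQ'.mem_iff.2 (by simp [hl]))
  refine key _ (L.map fun a => [a]) rfl ?_ ?_
  · rw [← List.flatMap_def]
    simp
  · intro l hl
    obtain ⟨a, -, rfl⟩ := List.mem_map.1 hl
    simp

end PathCover

/-! ### Red path powers through chains of cliques -/

section Blocks

open scoped Classical

variable {V : Type*}

/-- `Q` and `Q'` are robustly linked: a complete bipartite graph `K_{k,k}` between them survives the
removal of any `3k` vertices. -/
def Linked (R : SimpleGraph V) (k : ℕ) (Q Q' : Finset V) : Prop :=
  ∀ S : Finset V, S.card ≤ 3 * k → ∃ A ⊆ Q \ S, ∃ B ⊆ Q' \ S, A.card = k ∧ B.card = k ∧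
    ∀ a ∈ A, ∀ b ∈ B, R.Adj a b

theorem Linked.symm {R : SimpleGraph V} {k : ℕ} {Q Q' : Finset V} (h : Linked R k Q Q') :
    Linked R k Q' Q := by
  intro S hS
  obtain ⟨A, hA, B, hB, hAk, hBk, hAB⟩ := h S hS
  exact ⟨B, hB, A, hA, hBk, hAk, fun b hb a ha => (hAB a ha b hb).symm⟩

/-- `v` has at least `3k` neighbours in `Q`. -/
def Absorbable (R : SimpleGraph V) (k : ℕ) (Q : Finset V) (v : V) : Prop :=
  3 * k ≤ (Q.filter (R.Adj v)).card

/-- `B` is the clique `Q`, possibly enlarged by one absorbed vertex. -/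
def IsBlock (R : SimpleGraph V) (k : ℕ) (Q B : Finset V) : Prop :=
  R.IsClique (Q : Set V) ∧ 4 * k ≤ Q.card ∧
    (B = Q ∨ ∃ v ∉ Q, B = insert v Q ∧ Absorbable R k Q v)

theorem pairwise_adj_of_isClique {R : SimpleGraph V} {l : List V} {Q : Finset V}
    (hQ : R.IsClique (Q : Set V)) (hl : ∀ x ∈ l, x ∈ Q) (hn : l.Nodup) : l.Pairwise R.Adj :=
  hn.pairwise_of_forall_ne fun a ha b hb hab => hQ (hl a ha) (hl b hb) hab

theorem perm_toList_of_nodup {l : List V} {B : Finset V} (hn : l.Nodup)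
    (h : ∀ x, x ∈ l ↔ x ∈ B) : l.Perm B.toList := by
  rw [List.perm_ext_iff_of_nodup hn B.nodup_toList]
  simpa using h

/-- The block is traversed from a prescribed entry set `X` to an exit set `A`. An absorbed vertex
sits between two groups of k of its neighbours in the clique. `S` is what the exit must avoid: the
entry and these 2k neighbours. This is the origin of the constant 3k. -/
theorem IsBlock.exists_powerList {R : SimpleGraph V} {k : ℕ} {Q B X : Finset V}
    (h : IsBlock R k Q B) (hX : X ⊆ Q) (hXk : X.card = k) :
    ∃ S : Finset V, S.card ≤ 3 * k ∧ ∀ A ⊆ Q \ S, A.card = k →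
      ∃ m, IsPowerList R k (X.toList ++ m ++ A.toList) ∧
        (X.toList ++ m ++ A.toList).Perm B.toList := by
  obtain ⟨hQ, hcard, rfl | ⟨v, hv, rfl, habs⟩⟩ := h
  · refine ⟨X, by omega, fun A hA hAk => ⟨(B \ (X ∪ A)).toList, ?_⟩⟩
    have hn : (X.toList ++ (B \ (X ∪ A)).toList ++ A.toList).Nodup := by
      simp only [List.nodup_append, Finset.nodup_toList, Finset.mem_toList, List.mem_append,
        Finset.mem_sdiff, Finset.mem_union, true_and]
      grind
    have hmem : ∀ x, x ∈ (X.toList ++ (B \ (X ∪ A)).toList ++ A.toList) ↔ x ∈ B := by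
      intro x
      simp only [Finset.mem_toList, List.mem_append, Finset.mem_sdiff, Finset.mem_union]
      grind
    exact ⟨isPowerList_of_pairwise (pairwise_adj_of_isClique hQ (fun x hx => (hmem x).1 hx) hn),
      perm_toList_of_nodup hn hmem⟩
  · have h2 : 2 * k ≤ ((Q.filter (R.Adj v)) \ X).card := by
      have := Finset.le_card_sdiff X (Q.filter (R.Adj v))
      unfold Absorbable at habs
      omega
    obtain ⟨N, hN, hNk⟩ := Finset.exists_subset_card_eq h2
    obtain ⟨N₁, hN₁, hN₁k⟩ := Finset.exists_subset_card_eq (show k ≤ N.card by omega)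
    have hN₂k : (N \ N₁).card = k := by
      rw [Finset.card_sdiff_of_subset hN₁]; omega
    set N₂ := N \ N₁ with hN₂
    have hNQ : ∀ x ∈ N, x ∈ Q ∧ R.Adj v x ∧ x ∉ X := by
      intro x hx
      have := hN hx
      simp at this
      tauto
    refine ⟨X ∪ N, (Finset.card_union_le _ _).trans (by omega), fun A hA hAk => ?_⟩
    set T := Q \ (X ∪ N ∪ A) with hT
    refine ⟨N₁.toList ++ ([v] ++ (N₂.toList ++ T.toList)), ?_, ?_⟩
    · have p1 : (X.toList ++ N₁.toList).Pairwise R.Adj := by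
        refine pairwise_adj_of_isClique hQ ?_ ?_
        · simp only [Finset.mem_toList, List.mem_append]
          grind
        · simp only [List.nodup_append, Finset.nodup_toList, Finset.mem_toList, true_and]
          grind
      have p2' : (N₁.toList ++ N₂.toList).Pairwise R.Adj := by
        refine pairwise_adj_of_isClique hQ ?_ ?_
        · simp only [Finset.mem_toList, List.mem_append]
          grind
        · simp only [List.nodup_append, Finset.nodup_toList, Finset.mem_toList, true_and]
          grind
      have p2 : ((N₁.toList ++ [v]) ++ N₂.toList).Pairwise R.Adj := by
        rw [List.pairwise_append] at p2'
        simp only [List.append_assoc, List.pairwise_append, List.cons_append, List.nil_append,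
          List.pairwise_cons, List.mem_cons, Finset.mem_toList] at p2' ⊢
        refine ⟨p2'.1, ⟨fun x hx => (hNQ x ?_).2.1, p2'.2.1⟩, ?_⟩
        · grind
        · rintro a ha b (rfl | hb)
          · exact (hNQ a (hN₁ ha)).2.1.symm
          · exact p2'.2.2 a ha b hb
      have p3 : (N₂.toList ++ (T.toList ++ A.toList)).Pairwise R.Adj := by
        refine pairwise_adj_of_isClique hQ ?_ ?_
        · simp only [Finset.mem_toList, List.mem_append]
          grind
        · simp only [List.nodup_append, Finset.nodup_toList, Finset.mem_toList, true_and,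
            List.mem_append]
          grind
      have q1 := (isPowerList_of_pairwise (k := k) p2).append_overlap
        (isPowerList_of_pairwise p3) (by simp [hN₂k])
      have q2 := (isPowerList_of_pairwise (k := k) p1).append_overlap
        (l₂ := [v] ++ N₂.toList ++ (T.toList ++ A.toList)) (by simpa using q1) (by simp [hN₁k])
      simpa using q2
    · refine perm_toList_of_nodup ?_ ?_
      · simp only [List.nodup_append, Finset.nodup_toList, Finset.mem_toList, List.mem_append,
          List.nodup_singleton, List.mem_singleton, true_and]
        grind
      · intro x
        simp only [Finset.mem_toList, List.mem_append, List.mem_singleton, Finset.mem_insert]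
        grind

/-- The K_{k,k} between consecutive cliques supplies the exit set of one and the entry set of the
next. Keeping the entry set arbitrary is what lets the induction run. -/
theorem exists_powerList_of_chain {R : SimpleGraph V} {k : ℕ} {blk : Finset V → Finset V}
    (L : List (Finset V)) :
    ∀ Q : Finset V, (∀ P ∈ Q :: L, IsBlock R k P (blk P)) → (Q :: L).IsChain (Linked R k) →
      ∀ X ⊆ Q, X.card = k → ∃ l, IsPowerList R k (X.toList ++ l) ∧
        (X.toList ++ l).Perm ((Q :: L).flatMap fun P => (blk P).toList) := by
  induction L with
  | nil =>
    intro Q hb _ X hX hXk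
    have hQ := hb Q (by simp)
    obtain ⟨S, hS, h⟩ := hQ.exists_powerList hX hXk
    have : k ≤ (Q \ S).card := by
      have := Finset.le_card_sdiff S Q
      have := hQ.2.1
      omega
    obtain ⟨A, hA, hAk⟩ := Finset.exists_subset_card_eq this
    obtain ⟨m, h1, h2⟩ := h A hA hAk
    exact ⟨m ++ A.toList, by simpa using h1, by simpa using h2⟩
  | cons Q' L ih =>
    intro Q hb hc X hX hXk
    have hQ := hb Q (by simp)
    rw [List.isChain_cons_cons] at hc
    obtain ⟨S, hS, h⟩ := hQ.exists_powerList hX hXk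
    obtain ⟨A, hA, B, hB, hAk, hBk, hAB⟩ := hc.1 S hS
    obtain ⟨m, h1, h2⟩ := h A hA hAk
    have hB' : B ⊆ Q' := hB.trans Finset.sdiff_subset
    obtain ⟨l, h3, h4⟩ := ih Q' (fun P hP => hb P (List.mem_cons_of_mem _ hP)) hc.2 B hB' hBk
    refine ⟨m ++ A.toList ++ (B.toList ++ l), ?_, ?_⟩
    · have p : (A.toList ++ B.toList).Pairwise R.Adj := by
        rw [List.pairwise_append]
        refine ⟨pairwise_adj_of_isClique hQ.1 (fun x hx => ?_) A.nodup_toList,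
          pairwise_adj_of_isClique (hb Q' (by simp)).1 (fun x hx => ?_) B.nodup_toList, ?_⟩
        · exact (Finset.mem_sdiff.1 (hA (Finset.mem_toList.1 hx))).1
        · exact hB' (Finset.mem_toList.1 hx)
        · simpa using hAB
      have q1 := (isPowerList_of_pairwise (k := k) p).append_overlap h3 (by simp [hBk])
      have q2 := h1.append_overlap (l₂ := B.toList ++ l) (by simpa using q1) (by simp [hAk])
      simpa using q2
    · rw [List.flatMap_cons]
      simpa using h2.append h4

/-- A chain of linked cliques with absorbed vertices contains a path power on all its vertices. -/
theorem pathPower_isContained_of_chain {R : SimpleGraph V} {k n : ℕ}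
    {blk : Finset V → Finset V} {L : List (Finset V)} (hL : L.Nodup)
    (hb : ∀ P ∈ L, IsBlock R k P (blk P)) (hc : L.IsChain (Linked R k))
    (hd : ∀ P ∈ L, ∀ Q ∈ L, P ≠ Q → Disjoint (blk P) (blk Q)) (hne : L ≠ [])
    (hn : n ≤ (L.map fun P => (blk P).card).sum) : (pathPower n k).IsContained R := by
  obtain ⟨Q, L', rfl⟩ := List.exists_cons_of_ne_nil hne
  obtain ⟨X, hX, hXk⟩ := Finset.exists_subset_card_eq
    (show k ≤ Q.card by have := (hb Q (by simp)).2.1; omega)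
  obtain ⟨l, h1, h2⟩ := exists_powerList_of_chain L' Q hb hc X hX hXk
  refine h1.pathPower_isContained (h2.nodup_iff.2 ?_) ?_
  · rw [List.nodup_flatMap]
    refine ⟨fun P _ => (blk P).nodup_toList, hL.pairwise_of_forall_ne fun P hP P' hP' hne => ?_⟩
    intro x hx hx'
    exact Finset.disjoint_left.1 (hd P hP P' hP' hne) (Finset.mem_toList.1 hx)
      (Finset.mem_toList.1 hx')
  · rw [h2.length_eq, List.length_flatMap]
    simpa using hn

end Blocks

/-! ### Blue multipartite structure from unlinked cliques -/

section Blue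

open scoped Classical

variable {V : Type*}

/-- There is no complete bipartite `K_{k,k}` between `X` and `Z`. -/
def BicliqueFree (R : SimpleGraph V) (k : ℕ) (X Z : Finset V) : Prop :=
  ∀ A ⊆ X, ∀ B ⊆ Z, A.card = k → B.card = k → ∃ a ∈ A, ∃ b ∈ B, ¬ R.Adj a b

theorem BicliqueFree.mono {R : SimpleGraph V} {k : ℕ} {X Z X' Z' : Finset V}
    (h : BicliqueFree R k X Z) (hX : X' ⊆ X) (hZ : Z' ⊆ Z) : BicliqueFree R k X' Z' :=
  fun A hA B hB => h A (hA.trans hX) B (hB.trans hZ)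

/-- Kővári–Sós–Turán counting: each z with at least k neighbours in `X` selects a k-subset of them,
and no k-subset is selected more than k times. These z contribute at most |X| edges each, the others
fewer than k. -/
theorem BicliqueFree.sum_degree_le {R : SimpleGraph V} {k : ℕ} {X Z : Finset V}
    (h : BicliqueFree R k X Z) :
    ∑ v ∈ X, (Z.filter (R.Adj v)).card ≤ k * X.card ^ (k + 1) + k * Z.card := by
  have hswap : ∑ v ∈ X, (Z.filter (R.Adj v)).card = ∑ z ∈ Z, (X.filter fun v => R.Adj v z).card :=
    Finset.sum_card_bipartiteAbove_eq_sum_card_bipartiteBelow _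
  set bad := Z.filter fun z => k ≤ (X.filter fun v => R.Adj v z).card with hbad
  have hcard : bad.card ≤ k * X.card ^ k := by
    have hex : ∀ z, ∃ A : Finset V, z ∈ bad → A ⊆ (X.filter fun v => R.Adj v z) ∧ A.card = k := by
      intro z
      by_cases hz : z ∈ bad
      · obtain ⟨A, hA⟩ := Finset.exists_subset_card_eq (Finset.mem_filter.1 hz).2
        exact ⟨A, fun _ => hA⟩
      · exact ⟨∅, fun h => absurd h hz⟩
    choose f hf using hex
    have h1 : bad.card ≤ k * (X.powersetCard k).card := by
      refine Finset.card_le_mul_card_image_of_maps_to (f := f) ?_ k ?_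
      · intro z hz
        rw [Finset.mem_powersetCard]
        exact ⟨(hf z hz).1.trans (Finset.filter_subset _ _), (hf z hz).2⟩
      · intro A hA
        rw [Finset.mem_powersetCard] at hA
        by_contra! hlt
        obtain ⟨B, hB, hBk⟩ := Finset.exists_subset_card_eq hlt.le
        have hB' : ∀ b ∈ B, b ∈ bad ∧ f b = A := fun b hb => by simpa using hB hb
        obtain ⟨a, ha, b, hb, hab⟩ := h A hA.1 B
          (fun b hb => (Finset.mem_filter.1 (hB' b hb).1).1) hA.2 hBk
        have := (hf b (hB' b hb).1).1 ((hB' b hb).2.symm ▸ ha)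
        exact hab (Finset.mem_filter.1 this).2
    refine h1.trans (Nat.mul_le_mul_left _ ?_)
    rw [Finset.card_powersetCard]
    exact Nat.choose_le_pow _ _
  rw [hswap, ← Finset.sum_filter_add_sum_filter_not Z
    (fun z => k ≤ (X.filter fun v => R.Adj v z).card)]
  refine add_le_add ?_ ?_
  · calc ∑ z ∈ bad, (X.filter fun v => R.Adj v z).card ≤ ∑ z ∈ bad, X.card :=
        Finset.sum_le_sum fun z _ => Finset.card_filter_le _ _
      _ = bad.card * X.card := by simp
      _ ≤ k * X.card ^ k * X.card := Nat.mul_le_mul_right _ hcard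
      _ = k * X.card ^ (k + 1) := by ring
  · calc _ ≤ ∑ z ∈ Z.filter (fun z => ¬ k ≤ (X.filter fun v => R.Adj v z).card), k :=
        Finset.sum_le_sum fun z hz => (not_le.1 (Finset.mem_filter.1 hz).2).le
      _ = (Z.filter (fun z => ¬ k ≤ (X.filter fun v => R.Adj v z).card)).card * k := by simp
      _ ≤ Z.card * k := Nat.mul_le_mul_right _ (Finset.card_filter_le _ _)
      _ = k * Z.card := by ring

/-- Size of the probe sets. -/
def probeSize (k h : ℕ) : ℕ := 16 * k * h ^ 3

/-- Size of the cliques that make up the chains. -/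
def cliqueSize (k h : ℕ) : ℕ := probeSize k h ^ (k + 1)

/-- Degree above which a vertex is discarded. -/
def degreeCap (k h : ℕ) : ℕ := 4 * k * h * probeSize k h ^ k

/-- A greedy choice: from a small probe set in one `Z i`, take h vertices of low degree to every
other set, delete their neighbours there, and recurse. The term `I.card * (h * degreeCap k h)` is
the budget for these deletions. -/
theorem exists_independent_family {ι : Type*} {R : SimpleGraph V} {k h : ℕ} (hk : 1 ≤ k)
    (hh : 1 ≤ h) (I : Finset ι) : ∀ Z : ι → Finset V, I.card ≤ h →
    (∀ i ∈ I, (Z i).card ≤ cliqueSize k h) →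
    (∀ i ∈ I, probeSize k h + I.card * (h * degreeCap k h) ≤ (Z i).card) →
    (∀ i ∈ I, ∀ j ∈ I, i ≠ j → BicliqueFree R k (Z i) (Z j)) →
    ∃ Y : ι → Finset V, (∀ i ∈ I, Y i ⊆ Z i ∧ (Y i).card = h) ∧
      ∀ i ∈ I, ∀ j ∈ I, i ≠ j → ∀ a ∈ Y i, ∀ b ∈ Y j, ¬ R.Adj a b := by
  induction I using Finset.induction_on with
  | empty => exact fun Z _ _ _ _ => ⟨Z, by simp, by simp⟩
  | insert i I hi ih =>
    intro Z hIh hub hlb hfree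
    have hxpos : 0 < probeSize k h := by unfold probeSize; positivity
    have hDpos : 0 < degreeCap k h := by unfold degreeCap; positivity
    rw [Finset.card_insert_of_notMem hi] at hIh hlb
    obtain ⟨X, hX, hXc⟩ := Finset.exists_subset_card_eq
      (show probeSize k h ≤ (Z i).card from le_trans (Nat.le_add_right _ _) (hlb i (by simp)))
    set bad : ι → Finset V := fun j =>
      X.filter fun v => degreeCap k h < ((Z j).filter (R.Adj v)).card with hbad
    have hbadc : ∀ j ∈ I, (bad j).card ≤ 8 * k * h ^ 2 := by
      intro j hj
      have hij : i ≠ j := fun h => hi (h ▸ hj)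
      have h1 := ((hfree i (by simp) j (by simp [hj]) hij).mono hX subset_rfl).sum_degree_le
      have h2 : (bad j).card * degreeCap k h ≤ ∑ v ∈ X, ((Z j).filter (R.Adj v)).card := by
        calc (bad j).card * degreeCap k h = ∑ v ∈ bad j, degreeCap k h := by simp
          _ ≤ ∑ v ∈ bad j, ((Z j).filter (R.Adj v)).card :=
            Finset.sum_le_sum fun v hv => (Finset.mem_filter.1 hv).2.le
          _ ≤ _ := Finset.sum_le_sum_of_subset (Finset.filter_subset _ _)
      have h3 : (bad j).card * degreeCap k h ≤ 8 * k * h ^ 2 * degreeCap k h := by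
        refine h2.trans (h1.trans ?_)
        rw [hXc]
        calc _ ≤ k * probeSize k h ^ (k + 1) + k * cliqueSize k h :=
              Nat.add_le_add_left (Nat.mul_le_mul_left _ (hub j (by simp [hj]))) _
          _ = _ := by
              unfold degreeCap cliqueSize
              rw [pow_succ]
              nth_rewrite 2 [probeSize]
              nth_rewrite 3 [probeSize]
              ring
      exact Nat.le_of_mul_le_mul_right h3 hDpos
    -- `probeSize` is twice h · 8kh², so high-degree vertices fill at most half of the probe set.
    have hgood : h ≤ (X \ I.biUnion bad).card := by
      have h1 := Finset.le_card_sdiff (I.biUnion bad) X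
      have h2 : (I.biUnion bad).card ≤ I.card * (8 * k * h ^ 2) :=
        Finset.card_biUnion_le_card_mul _ _ _ hbadc
      have h3 : I.card * (8 * k * h ^ 2) ≤ h * (8 * k * h ^ 2) := Nat.mul_le_mul_right _ (by omega)
      have h4 : probeSize k h = h * (8 * k * h ^ 2) + h * (8 * k * h ^ 2) := by
        unfold probeSize; ring
      have h5 : h * 1 ≤ h * (8 * k * h ^ 2) := Nat.mul_le_mul_left _ (Nat.succ_le_of_lt (by positivity))
      omega
    obtain ⟨Y₀, hY₀, hY₀c⟩ := Finset.exists_subset_card_eq hgood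
    have hY₀d : ∀ j ∈ I, ∀ v ∈ Y₀, ((Z j).filter (R.Adj v)).card ≤ degreeCap k h := by
      intro j hj v hv
      by_contra! hlt
      have := Finset.mem_sdiff.1 (hY₀ hv)
      exact this.2 (Finset.mem_biUnion.2 ⟨j, hj, Finset.mem_filter.2 ⟨this.1, hlt⟩⟩)
    set Z' : ι → Finset V := fun j => Z j \ Y₀.biUnion fun v => (Z j).filter (R.Adj v) with hZ'
    have hZ'sub : ∀ j, Z' j ⊆ Z j := fun j => Finset.sdiff_subset
    obtain ⟨Y, hY, hYc⟩ := ih Z' (by omega)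
      (fun j hj => (Finset.card_le_card (hZ'sub j)).trans (hub j (by simp [hj])))
      (fun j hj => by
        have h1 := Finset.le_card_sdiff (Y₀.biUnion fun v => (Z j).filter (R.Adj v)) (Z j)
        have h2 : (Y₀.biUnion fun v => (Z j).filter (R.Adj v)).card ≤ Y₀.card * degreeCap k h :=
          Finset.card_biUnion_le_card_mul _ _ _ (hY₀d j hj)
        have h3 := hlb j (by simp [hj])
        rw [add_mul, one_mul] at h3
        rw [hY₀c] at h2
        change _ ≤ (Z j \ _).card
        omega)
      (fun a ha b hb hab => (hfree a (by simp [ha]) b (by simp [hb]) hab).mono (hZ'sub a) (hZ'sub b))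
    have hcross : ∀ j ∈ I, ∀ a ∈ Y₀, ∀ b ∈ Y j, ¬ R.Adj a b := by
      intro j hj a ha b hb hab
      have := Finset.mem_sdiff.1 ((hY j hj).1 hb)
      exact this.2 (Finset.mem_biUnion.2 ⟨a, ha, Finset.mem_filter.2 ⟨this.1, hab⟩⟩)
    have hne : ∀ j ∈ I, j ≠ i := fun j hj h => hi (h ▸ hj)
    refine ⟨fun j => if j = i then Y₀ else Y j, ?_, ?_⟩
    · intro j hj
      rcases Finset.mem_insert.1 hj with rfl | hj
      · simpa using ⟨hY₀.trans (Finset.sdiff_subset.trans hX), hY₀c⟩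
      · simpa [hne j hj] using ⟨(hY j hj).1.trans (hZ'sub j), (hY j hj).2⟩
    · intro a ha b hb hab
      rcases Finset.mem_insert.1 ha with ha' | ha' <;> rcases Finset.mem_insert.1 hb with hb' | hb'
      · exact absurd (ha'.trans hb'.symm) hab
      · simpa [ha', hne b hb'] using hcross b hb'
      · simpa [hb', hne a ha'] using fun x hx y hy h => hcross a ha' y hy x hx (SimpleGraph.Adj.symm h)
      · simpa [hne a ha', hne b hb'] using hYc a ha' b hb' hab

/-- Pairwise unlinked cliques contain `h`-sets with no edges between them, avoiding a given small
set. -/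
theorem exists_independent_family_of_not_linked {ι : Type*} {R : SimpleGraph V} {k h : ℕ}
    (hk : 1 ≤ k) (hh : 1 ≤ h) {I : Finset ι} {Q : ι → Finset V} (hI : I.card ≤ h)
    (hQ : ∀ i ∈ I, (Q i).card = cliqueSize k h)
    (hl : ∀ i ∈ I, ∀ j ∈ I, i ≠ j → ¬ Linked R k (Q i) (Q j)) {T : Finset V}
    (hT : ∀ i ∈ I, (Q i ∩ T).card ≤ 3 * k * h) :
    ∃ Y : ι → Finset V, (∀ i ∈ I, Y i ⊆ Q i \ T ∧ (Y i).card = h) ∧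
      ∀ i ∈ I, ∀ j ∈ I, i ≠ j → ∀ a ∈ Y i, ∀ b ∈ Y j, ¬ R.Adj a b := by
  have hex : ∀ i j, ∃ S : Finset V, S.card ≤ 3 * k ∧ (i ∈ I → j ∈ I → i ≠ j →
      BicliqueFree R k (Q i \ S) (Q j \ S)) := by
    intro i j
    by_cases hij : i ∈ I ∧ j ∈ I ∧ i ≠ j
    · have := hl i hij.1 j hij.2.1 hij.2.2
      unfold Linked at this
      push Not at this
      obtain ⟨S, hS, h⟩ := this
      exact ⟨S, hS, fun _ _ _ A hA B hB hAk hBk => h A hA B hB hAk hBk⟩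
    · exact ⟨∅, by simp, fun h1 h2 h3 => absurd ⟨h1, h2, h3⟩ hij⟩
  choose S hS hfree using hex
  set U := (I ×ˢ I).biUnion fun p => S p.1 p.2 with hU
  have hUc : U.card ≤ 3 * k * h ^ 2 := by
    have h1 : U.card ≤ (I ×ˢ I).card * (3 * k) :=
      Finset.card_biUnion_le_card_mul _ _ _ fun p _ => hS _ _
    rw [Finset.card_product] at h1
    calc U.card ≤ _ := h1
      _ ≤ h * h * (3 * k) := by gcongr
      _ = _ := by ring
  have hSU : ∀ i ∈ I, ∀ j ∈ I, S i j ⊆ U := fun i hi j hj => Finset.subset_biUnion_of_mem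
    (fun p : ι × ι => S p.1 p.2) (Finset.mk_mem_product hi hj)
  obtain ⟨Y, h1, h2⟩ := exists_independent_family (R := R) hk hh I (fun i => (Q i \ T) \ U) hI
    (fun i hi => (hQ i hi) ▸ Finset.card_le_card (Finset.sdiff_subset.trans Finset.sdiff_subset))
    (fun i hi => by
      have h3 := Finset.le_card_sdiff U (Q i \ T)
      have h4 := Finset.card_sdiff_add_card_inter (Q i) T
      have h5 := hT i hi
      have h6 := hQ i hi
      have h7 : I.card * (h * degreeCap k h) ≤ h * (h * degreeCap k h) :=
        Nat.mul_le_mul_right _ hI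
      -- The deletion budget is thus at most a quarter of a clique; the probe set and the removed
      -- sets `T` and `U` are of lower order.
      have h8 : 4 * (h * (h * degreeCap k h)) = cliqueSize k h := by
        unfold degreeCap cliqueSize
        rw [pow_succ]
        nth_rewrite 3 [probeSize]
        ring
      have hx : 16 ≤ probeSize k h := by
        unfold probeSize
        have : 0 < k * h ^ 3 := by positivity
        rw [mul_assoc]; omega
      have h9 : 16 * probeSize k h ≤ cliqueSize k h := by
        unfold cliqueSize
        calc 16 * probeSize k h ≤ probeSize k h ^ 1 * probeSize k h := by
              rw [pow_one]; exact Nat.mul_le_mul_right _ hx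
          _ ≤ probeSize k h ^ k * probeSize k h :=
              Nat.mul_le_mul_right _ (Nat.pow_le_pow_right (by omega) hk)
          _ = _ := (pow_succ _ _).symm
      have h10 : 3 * k * h + 3 * k * h ^ 2 ≤ probeSize k h := by
        unfold probeSize
        have a1 : k * h ≤ k * h ^ 3 := Nat.mul_le_mul_left _ (Nat.le_self_pow (by norm_num) h)
        have a2 : k * h ^ 2 ≤ k * h ^ 3 :=
          Nat.mul_le_mul_left _ (Nat.pow_le_pow_right hh (by norm_num))
        nlinarith
      show _ ≤ ((Q i \ T) \ U).card
      omega)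
    (fun i hi j hj hij => (hfree i j hi hj hij).mono
      (Finset.sdiff_subset_sdiff Finset.sdiff_subset (hSU i hi j hj))
      (Finset.sdiff_subset_sdiff Finset.sdiff_subset (hSU i hi j hj)))
  exact ⟨Y, fun i hi => ⟨(h1 i hi).1.trans Finset.sdiff_subset, (h1 i hi).2⟩, h2⟩

/-- Embedding of a coloured graph into a complete multipartite part of the complement. -/
theorem isContained_compl_of_family {W : Type*} [Fintype W] {H : SimpleGraph W} {r : ℕ}
    (C : H.Coloring (Fin r)) {R : SimpleGraph V} {Y : Fin r → Finset V}
    (hY : ∀ c, (C.colorClass c).ncard ≤ (Y c).card)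
    (hd : ∀ c d, c ≠ d → ∀ a ∈ Y c, ∀ b ∈ Y d, a ≠ b ∧ ¬ R.Adj a b) : H.IsContained Rᶜ := by
  rcases isEmpty_or_nonempty V with hV | hV
  · have : IsEmpty W := by
      refine ⟨fun w => ?_⟩
      have h1 := hY (C w)
      rw [Finset.eq_empty_of_isEmpty (Y (C w)), Finset.card_empty, Nat.le_zero,
        Set.ncard_eq_zero (Set.toFinite _)] at h1
      exact Set.eq_empty_iff_forall_notMem.1 h1 w rfl
    exact ⟨⟨⟨fun w => isEmptyElim w, fun {a} => isEmptyElim a⟩, fun a => isEmptyElim a⟩⟩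
  have hex : ∀ c, ∃ f : W → V, C.colorClass c ⊆ f ⁻¹' (Y c : Set V) ∧
      Set.InjOn f (C.colorClass c) := by
    intro c
    refine (Set.toFinite _).exists_injOn_of_encard_le ?_
    rw [← (Set.toFinite _).cast_ncard_eq, Set.encard_coe_eq_coe_finsetCard]
    exact_mod_cast hY c
  choose f hf hinj using hex
  have hmem : ∀ w, f (C w) w ∈ Y (C w) := fun w => hf (C w) rfl
  refine ⟨⟨⟨fun w => f (C w) w, ?_⟩, ?_⟩⟩
  · intro a b hab
    have := hd _ _ (C.valid hab) _ (hmem a) _ (hmem b)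
    rw [compl_adj]
    exact this
  · intro a b hab
    change f (C a) a = f (C b) b at hab
    by_cases h : C a = C b
    · refine hinj (C a) rfl h.symm ?_
      rw [hab, h]
    · exact absurd hab (hd _ _ h _ (hmem a) _ (hmem b)).1

/-- A set of at least `s ^ t` vertices has a clique of size `s` or an independent set of size
`t`. -/
theorem exists_clique_or_independent (R : SimpleGraph V) (s t : ℕ) (hs : 1 ≤ s) (ht : 1 ≤ t) :
    ∀ L : Finset V, s ^ t ≤ L.card → (∃ Q ⊆ L, R.IsClique (Q : Set V) ∧ Q.card = s) ∨
      ∃ J ⊆ L, J.card = t ∧ ∀ a ∈ J, ∀ b ∈ J, ¬ R.Adj a b := by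
  induction t, ht using Nat.le_induction with
  | base =>
    intro L hL
    obtain ⟨J, hJ, hJc⟩ := Finset.exists_subset_card_eq
      (show 1 ≤ L.card from le_trans (by simpa using hs) hL)
    refine Or.inr ⟨J, hJ, hJc, ?_⟩
    obtain ⟨v, rfl⟩ := Finset.card_eq_one.1 hJc
    simp
  | succ t ht ih =>
    intro L hL
    by_contra! hcon
    obtain ⟨hc, hi⟩ := hcon
    obtain ⟨Q, hQ, hmax⟩ := Finset.exists_max_image
      (L.powerset.filter fun Q : Finset V => R.IsClique (Q : Set V)) Finset.card ⟨∅, by simp⟩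
    simp only [Finset.mem_filter, Finset.mem_powerset] at hQ hmax
    have hQs : Q.card < s := by
      by_contra! hle
      obtain ⟨Q', hQ', hQ'c⟩ := Finset.exists_subset_card_eq hle
      exact hc Q' (hQ'.trans hQ.1) (hQ.2.subset (by exact_mod_cast hQ')) hQ'c
    -- A vertex adjacent to all of the maximum clique `Q` would enlarge it. As |Q| < s, some q must
    -- have at least s^t non-neighbours, which feeds the induction.
    have hcover : L ⊆ Q ∪ Q.biUnion fun q => L.filter fun v => v ≠ q ∧ ¬ R.Adj q v := by
      intro v hv
      by_contra hvn
      simp only [Finset.mem_union, Finset.mem_biUnion, Finset.mem_filter, not_or, not_exists,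
        not_and, not_not] at hvn
      have hcl : R.IsClique ((insert v Q : Finset V) : Set V) := by
        rw [Finset.coe_insert, isClique_insert]
        exact ⟨hQ.2, fun q hq hne => (hvn.2 q hq hv hne).symm⟩
      have := hmax _ ⟨Finset.insert_subset hv hQ.1, hcl⟩
      rw [Finset.card_insert_of_notMem hvn.1] at this
      omega
    have hsmall : ∀ q ∈ Q, (L.filter fun v => v ≠ q ∧ ¬ R.Adj q v).card ≤ s ^ t - 1 := by
      intro q hq
      by_contra! hlt
      rcases ih (L.filter fun v => v ≠ q ∧ ¬ R.Adj q v) (by omega) with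
        ⟨Q', hQ', h1, h2⟩ | ⟨J, hJ, h1, h2⟩
      · exact hc Q' (hQ'.trans (Finset.filter_subset _ _)) h1 h2
      · have hJq : ∀ a ∈ J, a ≠ q ∧ ¬ R.Adj q a := fun a ha => (Finset.mem_filter.1 (hJ ha)).2
        obtain ⟨a, ha, b, hb, hab⟩ := hi (insert q J)
          (Finset.insert_subset (hQ.1 hq) (hJ.trans (Finset.filter_subset _ _)))
          (by rw [Finset.card_insert_of_notMem fun h => (hJq q h).1 rfl, h1])
        rcases Finset.mem_insert.1 ha with ha' | ha' <;>
          rcases Finset.mem_insert.1 hb with hb' | hb'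
        · exact R.loopless.irrefl q (by rwa [ha', hb'] at hab)
        · exact (hJq b hb').2 (ha' ▸ hab)
        · exact (hJq a ha').2 (hb' ▸ hab).symm
        · exact h2 a ha' b hb' hab
    have h1 := Finset.card_le_card hcover
    have h2 := Finset.card_union_le Q (Q.biUnion fun q => L.filter fun v => v ≠ q ∧ ¬ R.Adj q v)
    have h3 := Finset.card_biUnion_le_card_mul Q _ _ hsmall
    have h4 : 1 ≤ s ^ t := Nat.one_le_pow _ _ hs
    obtain ⟨p, hp⟩ : ∃ p, s ^ t = p + 1 := ⟨s ^ t - 1, by omega⟩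
    rw [pow_succ, hp] at hL
    rw [hp] at h3
    simp only [Nat.add_sub_cancel] at h3
    have h5 : Q.card + Q.card * p = Q.card * (p + 1) := by ring
    have h6 : Q.card * (p + 1) < s * (p + 1) := Nat.mul_lt_mul_of_pos_right hQs (by omega)
    have h7 : (p + 1) * s = s * (p + 1) := by ring
    omega

end Blue

/-! ### Basic facts on χ and σ -/

section Chi

theorem sigma_le_ncard {W : Type*} {H : SimpleGraph W} (C : H.Coloring (Fin (chi H))) (c : Fin (chi H)) :
    sigma H ≤ (C.colorClass c).ncard := Nat.sInf_le ⟨C, c, rfl⟩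

variable {W : Type*} [Fintype W] (H : SimpleGraph W)

theorem colorable_chi : H.Colorable (chi H) := H.colorable_chromaticNumber_of_fintype

theorem chi_le_card : chi H ≤ Fintype.card W := by
  have h := chromaticNumber_le_card (G := H)
  simpa [chi] using ENat.toNat_le_toNat h (by simp)

theorem chi_pos [Nonempty W] : 0 < chi H := by
  obtain ⟨C⟩ := colorable_chi H
  obtain ⟨w⟩ := ‹Nonempty W›
  exact Fin.pos (C w)

theorem exists_coloring_sigma [Nonempty W] :
    ∃ (C : H.Coloring (Fin (chi H))) (c : Fin (chi H)), sigma H = (C.colorClass c).ncard := by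
  obtain ⟨C⟩ := colorable_chi H
  exact Nat.sInf_mem (s := {m : ℕ | ∃ (C : H.Coloring (Fin (chi H))) (c : Fin (chi H)),
    m = (C.colorClass c).ncard}) ⟨_, C, ⟨0, chi_pos H⟩, rfl⟩

theorem ncard_le_fintypeCard (s : Set W) : s.ncard ≤ Fintype.card W := by
  rw [← Nat.card_eq_fintype_card, ← Set.ncard_univ]
  exact Set.ncard_le_ncard (Set.subset_univ _)

theorem sigma_le_card [Nonempty W] : sigma H ≤ Fintype.card W := by
  obtain ⟨C, c, h⟩ := exists_coloring_sigma H
  exact h ▸ ncard_le_fintypeCard _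

end Chi

/-! ### Packing, absorption and trimming tools -/

section Upper

open scoped Classical

variable {V : Type*}

theorem isContained_compl_of_independent {W : Type*} [Fintype W] {H : SimpleGraph W}
    {R : SimpleGraph V} {J : Finset V} (hJ : J.card = Fintype.card W)
    (h : ∀ a ∈ J, ∀ b ∈ J, ¬ R.Adj a b) : H.IsContained Rᶜ := by
  have e : W ≃ J := Fintype.equivOfCardEq (by simp [hJ])
  refine ⟨⟨⟨fun w => (e w : V), ?_⟩, fun a b hab => e.injective (Subtype.ext hab)⟩⟩
  intro a b hab
  rw [compl_adj]
  exact ⟨fun h => hab.ne (e.injective (Subtype.ext h)), h _ (e a).2 _ (e b).2⟩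

theorem exists_family_of_list {ι : Type*} {R : SimpleGraph V} {k h : ℕ}
    (hk : 1 ≤ k) (hh : 1 ≤ h) {I : Finset ι} {D : List (Finset V)} {T : Finset V}
    (hD : D.Pairwise fun Q Q' => ¬ Linked R k Q Q' ∧ Disjoint Q Q')
    (hs : ∀ Q ∈ D, Q.card = cliqueSize k h ∧ (Q ∩ T).card ≤ 3 * k * h)
    (hI : I.card ≤ h) (hID : I.card ≤ D.length) :
    ∃ Y : ι → Finset V, (∀ i ∈ I, Disjoint (Y i) T ∧ (Y i).card = h) ∧
      ∀ i ∈ I, ∀ j ∈ I, i ≠ j → ∀ a ∈ Y i, ∀ b ∈ Y j, a ≠ b ∧ ¬ R.Adj a b := by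
  obtain ⟨φ, hφ, hinj⟩ := I.finite_toSet.exists_injOn_of_encard_le
    (t := (Finset.range D.length : Set ℕ)) (by
      rw [Set.encard_coe_eq_coe_finsetCard, Set.encard_coe_eq_coe_finsetCard]
      simpa using hID)
  have hlt : ∀ i ∈ I, φ i < D.length := fun i hi => by simpa using hφ hi
  have hmem : ∀ i ∈ I, D.getD (φ i) ∅ ∈ D := fun i hi => by
    rw [List.getD_eq_getElem _ _ (hlt i hi)]; exact List.getElem_mem _
  have hpair : ∀ i ∈ I, ∀ j ∈ I, i ≠ j →
      ¬ Linked R k (D.getD (φ i) ∅) (D.getD (φ j) ∅) ∧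
        Disjoint (D.getD (φ i) ∅) (D.getD (φ j) ∅) := by
    intro i hi j hj hij
    rw [List.getD_eq_getElem _ _ (hlt i hi), List.getD_eq_getElem _ _ (hlt j hj)]
    rw [List.pairwise_iff_getElem] at hD
    rcases lt_trichotomy (φ i) (φ j) with h | h | h
    · exact hD _ _ (hlt i hi) (hlt j hj) h
    · exact absurd (hinj hi hj h) hij
    · have := hD _ _ (hlt j hj) (hlt i hi) h
      exact ⟨fun h => this.1 h.symm, this.2.symm⟩
  obtain ⟨Y, h1, h2⟩ := exists_independent_family_of_not_linked (R := R) hk hh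
    (Q := fun i => D.getD (φ i) ∅) hI (fun i hi => (hs _ (hmem i hi)).1)
    (fun i hi j hj hij => (hpair i hi j hj hij).1) (T := T) (fun i hi => (hs _ (hmem i hi)).2)
  refine ⟨Y, fun i hi => ⟨?_, (h1 i hi).2⟩, fun i hi j hj hij a ha b hb => ⟨?_, ?_⟩⟩
  · exact Finset.disjoint_of_subset_left (h1 i hi).1 Finset.sdiff_disjoint
  · rintro rfl
    exact Finset.disjoint_left.1 (hpair i hi j hj hij).2 (Finset.mem_sdiff.1 ((h1 i hi).1 ha)).1
      (Finset.mem_sdiff.1 ((h1 j hj).1 hb)).1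
  · exact h2 i hi j hj hij a ha b hb

/-- Disjoint cliques of size `s` that leave few vertices uncovered. -/
theorem exists_clique_packing [Fintype V] (R : SimpleGraph V) {s t : ℕ} (hs : 1 ≤ s) (ht : 1 ≤ t)
    (hJ : ¬ ∃ J : Finset V, J.card = t ∧ ∀ a ∈ J, ∀ b ∈ J, ¬ R.Adj a b) :
    ∃ 𝒬 : Finset (Finset V), (∀ Q ∈ 𝒬, R.IsClique (Q : Set V) ∧ Q.card = s) ∧
      (∀ Q ∈ 𝒬, ∀ Q' ∈ 𝒬, Q ≠ Q' → Disjoint Q Q') ∧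
      (Finset.univ \ 𝒬.biUnion id).card < s ^ t := by
  obtain ⟨𝒬, h𝒬, hmax⟩ := Finset.exists_max_image
    (Finset.univ.filter fun 𝒬 : Finset (Finset V) =>
      (∀ Q ∈ 𝒬, R.IsClique (Q : Set V) ∧ Q.card = s) ∧
      (∀ Q ∈ 𝒬, ∀ Q' ∈ 𝒬, Q ≠ Q' → Disjoint Q Q')) Finset.card ⟨∅, by simp⟩
  simp only [Finset.mem_filter, Finset.mem_univ, true_and] at h𝒬 hmax
  refine ⟨𝒬, h𝒬.1, h𝒬.2, ?_⟩
  by_contra! hle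
  rcases exists_clique_or_independent R s t hs ht _ hle with ⟨Q, hQ, h1, h2⟩ | ⟨J, -, h1, h2⟩
  · have hdis : ∀ Q' ∈ 𝒬, Disjoint Q Q' := by
      intro Q' hQ'
      rw [Finset.disjoint_left]
      intro x hx hx'
      exact (Finset.mem_sdiff.1 (hQ hx)).2 (Finset.mem_biUnion.2 ⟨Q', hQ', hx'⟩)
    have hnot : Q ∉ 𝒬 := by
      intro h
      have := disjoint_self.1 (hdis Q h)
      simp only [Finset.bot_eq_empty] at this
      simp [this] at h2
      omega
    have := hmax (insert Q 𝒬) ⟨?_, ?_⟩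
    · rw [Finset.card_insert_of_notMem hnot] at this
      omega
    · intro P hP
      rcases Finset.mem_insert.1 hP with rfl | hP
      · exact ⟨h1, h2⟩
      · exact h𝒬.1 P hP
    · intro P hP P' hP' hne
      rcases Finset.mem_insert.1 hP with hP | hP <;> rcases Finset.mem_insert.1 hP' with hP' | hP'
      · exact absurd (hP.trans hP'.symm) hne
      · exact hP ▸ hdis P' hP'
      · exact hP' ▸ (hdis P hP).symm
      · exact h𝒬.2 P hP P' hP' hne
  · exact hJ ⟨J, h1, h2⟩

/-- A maximal partial matching of `L` into `𝒬` along a relation. -/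
theorem exists_maximal_matching {α β : Type*} [Nonempty β] (p : β → α → Prop) (L : Finset α)
    (𝒬 : Finset β) :
    ∃ (A : Finset α) (e : α → β), A ⊆ L ∧ Set.InjOn e A ∧ (∀ v ∈ A, e v ∈ 𝒬 ∧ p (e v) v) ∧
      ∀ v ∈ L \ A, ∀ Q ∈ 𝒬, (∀ a ∈ A, e a ≠ Q) → ¬ p Q v := by
  obtain ⟨A, hA, hmax⟩ := Finset.exists_max_image
    (L.powerset.filter fun A : Finset α => ∃ e : α → β, Set.InjOn e A ∧ ∀ v ∈ A, e v ∈ 𝒬 ∧ p (e v) v)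
    Finset.card ⟨∅, by simp⟩
  simp only [Finset.mem_filter, Finset.mem_powerset] at hA hmax
  obtain ⟨hAL, e, he, hp⟩ := hA
  refine ⟨A, e, hAL, he, hp, fun v hv Q hQ hQA hpv => ?_⟩
  rw [Finset.mem_sdiff] at hv
  have hup : ∀ a ∈ A, Function.update e v Q a = e a := fun a ha =>
    Function.update_of_ne (fun h : a = v => hv.2 (h ▸ ha)) _ _
  have := hmax (insert v A) ⟨Finset.insert_subset hv.1 hAL, Function.update e v Q, ?_, ?_⟩
  · rw [Finset.card_insert_of_notMem hv.2] at this
    omega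
  · rw [Finset.coe_insert, Set.injOn_insert (by simpa using hv.2)]
    refine ⟨fun a ha b hb hab => he ha hb (by rwa [hup a ha, hup b hb] at hab), ?_⟩
    rintro ⟨a, ha, hab⟩
    rw [hup a ha, Function.update_self] at hab
    exact hQA a ha hab
  · intro a ha
    rcases Finset.mem_insert.1 ha with rfl | ha
    · simpa using ⟨hQ, hpv⟩
    · rw [hup a ha]
      exact hp a ha

/-- The initial run of members of `U` has no repetitions, so dropping it costs at most |U| entries.
-/
theorem exists_suffix_of_length_gt {β : Type*} (U : Finset β) {l : List β} (hl : l.Nodup)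
    (hU : U.card < l.length) : ∃ q m, q ∉ U ∧ (q :: m) <:+ l ∧ l.length ≤ (q :: m).length + U.card := by
  have h1 : (l.takeWhile (· ∈ U)).length ≤ U.card := by
    rw [← List.toFinset_card_of_nodup (hl.sublist (List.takeWhile_sublist _))]
    refine Finset.card_le_card fun x hx => ?_
    simpa using List.mem_takeWhile_imp (List.mem_toFinset.1 hx)
  have h2 : (l.takeWhile (· ∈ U)).length + (l.dropWhile (· ∈ U)).length = l.length := by
    rw [← List.length_append, List.takeWhile_append_dropWhile]
  have h3 : l.dropWhile (· ∈ U) ≠ [] := by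
    intro h
    rw [h, List.length_nil] at h2
    omega
  have h4 := List.head_dropWhile_not (· ∈ U) h3
  obtain ⟨q, m, hqm⟩ := List.exists_cons_of_ne_nil h3
  have h5 := List.dropWhile_suffix (l := l) (· ∈ U)
  simp only [hqm, List.head_cons, decide_eq_false_iff_not] at h4
  rw [hqm] at h2 h5
  exact ⟨q, m, h4, h5, by omega⟩

end Upper

/-! ### The upper bound -/

section Upper

open scoped Classical

variable {V : Type*}

theorem sum_map_le_of_forall {β : Type*} (L : List β) (f : β → ℕ) (c : ℕ)
    (h : ∀ x ∈ L, f x ≤ c) : (L.map f).sum ≤ L.length * c := by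
  simpa using List.sum_le_card_nsmul (L.map f) c (by simpa using h)

theorem mul_length_le_sum_map {β : Type*} (L : List β) (f : β → ℕ) (c : ℕ)
    (h : ∀ x ∈ L, c ≤ f x) : c * L.length ≤ (L.map f).sum := by
  simpa [mul_comm] using List.card_nsmul_le_sum (L.map f) c (by simpa using h)

theorem pathPower_or_isContained [Fintype V] {W : Type*} [Fintype W] [Nonempty W]
    (R : SimpleGraph V) (H : SimpleGraph W) {k n : ℕ} (hk : 1 ≤ k)
    (hn : 4 * cliqueSize k (Fintype.card W) ^ Fintype.card W * cliqueSize k (Fintype.card W) ≤ n)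
    (hN : (chi H - 1) * (n - 1) + sigma H ≤ Fintype.card V) :
    (pathPower n k).IsContained R ∨ H.IsContained Rᶜ := by
  by_contra hcon
  rw [not_or] at hcon
  obtain ⟨hred, hblue⟩ := hcon
  set h := Fintype.card W with hh
  have hh1 : 1 ≤ h := Fintype.card_pos
  set s := cliqueSize k h with hs
  set Cc := s ^ h with hCc
  have hx16 : 16 * k ≤ probeSize k h := by
    unfold probeSize
    exact Nat.le_mul_of_pos_right _ (by positivity)
  have hsx : probeSize k h ≤ s := Nat.le_self_pow (by omega) _
  have hs1 : 1 ≤ s := by omega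
  have hCc1 : 1 ≤ Cc := Nat.one_le_pow _ _ hs1
  have hCs : Cc ≤ Cc * s := Nat.le_mul_of_pos_right _ hs1
  have hn' : 4 * (Cc * s) ≤ n := by rw [← mul_assoc]; exact hn
  -- packing by cliques
  obtain ⟨𝒬, hQc, hQd, hL⟩ := exists_clique_packing R hs1 hh1 (fun ⟨J, h1, h2⟩ =>
    hblue (isContained_compl_of_independent h1 h2))
  set L := Finset.univ \ 𝒬.biUnion id with hLdef
  have hLQ : ∀ v ∈ L, ∀ Q ∈ 𝒬, v ∉ Q := fun v hv Q hQ hvQ =>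
    (Finset.mem_sdiff.1 hv).2 (Finset.mem_biUnion.2 ⟨Q, hQ, hvQ⟩)
  -- absorption
  obtain ⟨A, e, hAL, heinj, heA, hemax⟩ := exists_maximal_matching (Absorbable R k) L 𝒬
  set U := A.image e with hU
  have hUc : U.card < Cc :=
    (Finset.card_image_le.trans (Finset.card_le_card hAL)).trans_lt hL
  set blk : Finset V → Finset V := fun Q => Q ∪ A.filter (fun v => e v = Q) with hblk
  have hblkc : ∀ Q ∈ 𝒬, s ≤ (blk Q).card := fun Q hQ =>
    (hQc Q hQ).2 ▸ Finset.card_le_card Finset.subset_union_left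
  have hisblk : ∀ Q ∈ 𝒬, IsBlock R k Q (blk Q) := by
    intro Q hQ
    refine ⟨(hQc Q hQ).1, by rw [(hQc Q hQ).2]; omega, ?_⟩
    by_cases hex : ∃ v ∈ A, e v = Q
    · obtain ⟨v, hv, rfl⟩ := hex
      refine Or.inr ⟨v, hLQ v (hAL hv) _ hQ, ?_, (heA v hv).2⟩
      have : A.filter (fun w => e w = e v) = {v} := by
        ext w
        simp only [Finset.mem_filter, Finset.mem_singleton]
        refine ⟨fun hw => heinj hw.1 hv hw.2, ?_⟩
        rintro rfl
        exact ⟨hv, rfl⟩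
      simp only [hblk, this]
      rw [Finset.union_comm, Finset.insert_eq]
    · refine Or.inl ?_
      have : A.filter (fun w => e w = Q) = ∅ := by
        rw [Finset.filter_eq_empty_iff]
        exact fun v hv hvQ => hex ⟨v, hv, hvQ⟩
      simp [hblk, this]
  have hblkd : ∀ P ∈ 𝒬, ∀ Q ∈ 𝒬, P ≠ Q → Disjoint (blk P) (blk Q) := by
    intro P hP Q hQ hne
    rw [Finset.disjoint_left]
    intro x hx hx'
    rcases Finset.mem_union.1 hx with hx | hx <;> rcases Finset.mem_union.1 hx' with hx' | hx'
    · exact Finset.disjoint_left.1 (hQd P hP Q hQ hne) hx hx'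
    · exact hLQ x (hAL (Finset.mem_filter.1 hx').1) P hP hx
    · exact hLQ x (hAL (Finset.mem_filter.1 hx).1) Q hQ hx'
    · exact hne ((Finset.mem_filter.1 hx).2.symm.trans (Finset.mem_filter.1 hx').2)
  have hshort : ∀ l : List (Finset V), l.Nodup → (∀ P ∈ l, P ∈ 𝒬) → l.IsChain (Linked R k) →
      (l.map fun P => (blk P).card).sum ≤ n - 1 := by
    intro l hl hl𝒬 hc
    by_contra! hlt
    rcases eq_or_ne l [] with rfl | hne
    · simp at hlt
    · exact hred (pathPower_isContained_of_chain hl (fun P hP => hisblk P (hl𝒬 P hP)) hc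
        (fun P hP Q hQ => hblkd P (hl𝒬 P hP) Q (hl𝒬 Q hQ)) hne (by omega))
  -- chains
  obtain ⟨P, hPperm, hPc, hPheads⟩ := exists_path_cover (Linked R k) (fun _ _ => Linked.symm)
    𝒬.toList
  have hPnd : P.flatten.Nodup := hPperm.nodup_iff.2 𝒬.nodup_toList
  rw [List.nodup_flatten] at hPnd
  have hP𝒬 : ∀ l ∈ P, ∀ Q ∈ l, Q ∈ 𝒬 := fun l hl Q hQ =>
    Finset.mem_toList.1 (hPperm.mem_iff.1 (List.mem_flatten.2 ⟨l, hl, hQ⟩))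
  have hPshort : ∀ l ∈ P, (l.map fun P => (blk P).card).sum ≤ n - 1 := fun l hl =>
    hshort l (hPnd.1 l hl) (hP𝒬 l hl) (hPc l hl).2
  have hsumP : ∀ f : Finset V → ℕ, (P.map fun l => (l.map f).sum).sum = ∑ Q ∈ 𝒬, f Q := by
    intro f
    rw [Finset.sum_eq_multiset_sum, ← Finset.coe_toList, Multiset.map_coe, Multiset.sum_coe,
      ← (hPperm.map f).sum_eq, List.map_flatten, List.sum_flatten, List.map_map]
    rfl
  have hheads_disj : ∀ {l m : List (Finset V)} {Q Q' : Finset V}, l ∈ P → m ∈ P →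
      l.Disjoint m → Q ∈ l → Q' ∈ m → Disjoint Q Q' := by
    intro l m Q Q' hl hm hd hQ hQ'
    exact hQd Q (hP𝒬 l hl Q hQ) Q' (hP𝒬 m hm Q' hQ') fun h => hd hQ (h ▸ hQ')
  obtain ⟨Cl, c₀, hc₀⟩ := exists_coloring_sigma H
  have hclass : ∀ c, (Cl.colorClass c).ncard ≤ h := fun c => ncard_le_fintypeCard _
  have hr1 := chi_pos H
  have hrh : chi H ≤ h := chi_le_card H
  -- few chains
  have hPlen : P.length < chi H := by
    by_contra! hle
    obtain ⟨Y, hY, hYd⟩ := exists_family_of_list (R := R) (k := k) hk hh1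
      (I := (Finset.univ : Finset (Fin (chi H)))) (D := P.map fun l => l.headD ∅) (T := ∅) (by
        rw [List.pairwise_map]
        refine (hPheads.and hPnd.2).imp_of_mem fun {l m} hl hm hlm => ?_
        obtain ⟨q, l', rfl⟩ := List.exists_cons_of_ne_nil (hPc l hl).1
        obtain ⟨q', m', rfl⟩ := List.exists_cons_of_ne_nil (hPc m hm).1
        exact ⟨hlm.1 q (by simp) q' (by simp),
          hheads_disj hl hm hlm.2 (by simp) (by simp)⟩) (by
        intro Q hQ
        obtain ⟨l, hl, rfl⟩ := List.mem_map.1 hQ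
        obtain ⟨q, l', rfl⟩ := List.exists_cons_of_ne_nil (hPc l hl).1
        exact ⟨(hQc q (hP𝒬 _ hl q (by simp))).2, by simp⟩) (by simpa using hrh) (by simpa using hle)
    exact hblue (isContained_compl_of_family Cl (fun c => (hclass c).trans (hY c (by simp)).2.ge)
      (fun c d hcd => hYd c (by simp) d (by simp) hcd))
  -- counting
  have hcount1 : Fintype.card V ≤ (L \ A).card + ∑ Q ∈ 𝒬, (blk Q).card := by
    have hcov : (Finset.univ : Finset V) ⊆ (L \ A) ∪ 𝒬.biUnion blk := by
      intro v _
      rw [Finset.mem_union, Finset.mem_biUnion, Finset.mem_sdiff]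
      by_cases hvL : v ∈ L
      · by_cases hvA : v ∈ A
        · exact Or.inr ⟨e v, (heA v hvA).1, Finset.mem_union_right _ (by simp [hvA])⟩
        · exact Or.inl ⟨hvL, hvA⟩
      · have : v ∈ 𝒬.biUnion id := by simpa [hLdef] using hvL
        obtain ⟨Q, hQ, hv⟩ := Finset.mem_biUnion.1 this
        exact Or.inr ⟨Q, hQ, Finset.mem_union_left _ hv⟩
    calc Fintype.card V = (Finset.univ : Finset V).card := rfl
      _ ≤ _ := Finset.card_le_card hcov
      _ ≤ _ := Finset.card_union_le _ _
      _ ≤ _ := Nat.add_le_add_left Finset.card_biUnion_le _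
  have hcount2 : Fintype.card V ≤ L.card + ∑ Q ∈ 𝒬, s := by
    have h1 : Fintype.card V ≤ L.card + (𝒬.biUnion id).card := by
      have := Finset.le_card_sdiff (𝒬.biUnion id) Finset.univ
      rw [Finset.card_univ, ← hLdef] at this
      omega
    refine h1.trans (Nat.add_le_add_left (Finset.card_biUnion_le.trans ?_) _)
    exact Finset.sum_le_sum fun Q hQ => (hQc Q hQ).2.le
  have hsumle : ∑ Q ∈ 𝒬, (blk Q).card ≤ P.length * (n - 1) := by
    rw [← hsumP]
    exact sum_map_le_of_forall _ _ _ hPshort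
  have hLA : (L \ A).card ≤ L.card := Finset.card_le_card Finset.sdiff_subset
  have hlen : P.length = chi H - 1 := by
    by_contra hne
    have h1 : P.length + 1 ≤ chi H - 1 := by omega
    have h2 := Nat.mul_le_mul_right (n - 1) h1
    rw [add_mul, one_mul] at h2
    omega
  -- The χ(H)-1 chains, absorbed vertices included, cover at most (χ(H)-1)(n-1) vertices.
  have hunabs : sigma H ≤ (L \ A).card := by
    rw [hlen] at hsumle
    omega
  -- The other χ(H)-2 chains hold at most n-1 vertices each and fewer than `Cc` lie outside the
  -- cliques, so this chain must hold the rest.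
  have hlong : ∀ l ∈ P, n - 1 ≤ s * l.length + Cc := by
    intro l hl
    have h1 := hsumP fun _ => s
    have h2 := ((List.perm_cons_erase hl).map fun l : List (Finset V) =>
      (l.map fun _ => s).sum).sum_eq
    rw [h1, List.map_cons, List.sum_cons] at h2
    have h3 := sum_map_le_of_forall (P.erase l) (fun l => (l.map fun _ => s).sum) (n - 1)
      (fun m hm => (List.sum_le_sum fun Q hQ =>
        hblkc Q (hP𝒬 m (List.mem_of_mem_erase hm) Q hQ)).trans
          (hPshort m (List.mem_of_mem_erase hm)))
    have h4 := List.length_pos_of_mem hl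
    rw [List.length_erase_of_mem hl, hlen] at h3
    rw [hlen] at h4
    obtain ⟨p, hp⟩ : ∃ p, chi H - 1 = p + 1 := ⟨chi H - 1 - 1, by omega⟩
    rw [hp] at h3 hN
    rw [Nat.add_sub_cancel] at h3
    rw [add_mul, one_mul] at hN
    have h5 : (l.map fun _ => s).sum = s * l.length := by simp [mul_comm]
    omega
  -- drop the cliques that absorbed a vertex from the start of each chain
  have hdrop : ∀ l : List (Finset V), ∃ q m, l ∈ P → q ∉ U ∧ (q :: m) <:+ l ∧
      l.length ≤ (q :: m).length + U.card := by
    intro l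
    by_cases hl : l ∈ P
    · obtain ⟨q, m, h1⟩ := exists_suffix_of_length_gt U (hPnd.1 l hl) (by
        by_contra! hle
        have h1 := hlong l hl
        have h2 : s * l.length ≤ Cc * s := by
          rw [mul_comm]; exact Nat.mul_le_mul_right _ (by omega)
        omega)
      exact ⟨q, m, fun _ => h1⟩
    · exact ⟨∅, [], fun h => absurd h hl⟩
  choose q m hqm using hdrop
  have hqmem : ∀ l ∈ P, q l ∈ l := fun l hl => (hqm l hl).2.1.subset (by simp)
  have hunl : ∀ l ∈ P, ∀ l' ∈ P, l.Disjoint l' → ¬ Linked R k (q l) (q l') := by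
    intro l hl l' hl' hd hlink
    obtain ⟨-, h1, h2⟩ := hqm l hl
    obtain ⟨-, h1', h2'⟩ := hqm l' hl'
    -- Each trimmed chain lost at most `Cc` and `s * U.card` vertices from n-1. As n ≥ 4·`Cc`·s, the
    -- two glued at their heads exceed n-1.
    have h3 := hshort ((q l :: m l).reverse ++ (q l' :: m l')) ?_ ?_ ?_
    · have h4 := mul_length_le_sum_map ((q l :: m l).reverse ++ (q l' :: m l'))
        (fun P => (blk P).card) s (fun Q hQ => hblkc Q ?_)
      · have h5 := hlong l hl
        have h6 := hlong l' hl'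
        have h7 := Nat.mul_le_mul_left s h2
        have h8 := Nat.mul_le_mul_left s h2'
        have h9 : s * U.card + s ≤ Cc * s := by
          rw [mul_comm Cc, ← Nat.mul_succ]
          exact Nat.mul_le_mul_left _ hUc
        rw [List.length_append, List.length_reverse, mul_add] at h4
        rw [mul_add] at h7 h8
        omega
      · rcases List.mem_append.1 hQ with hQ | hQ
        · exact hP𝒬 l hl Q (h1.subset (List.mem_reverse.1 hQ))
        · exact hP𝒬 l' hl' Q (h1'.subset hQ)
    · rw [List.nodup_append]
      refine ⟨List.nodup_reverse.2 ((hPnd.1 l hl).sublist h1.sublist),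
        (hPnd.1 l' hl').sublist h1'.sublist, fun a ha b hb hab => ?_⟩
      exact hd (h1.subset (List.mem_reverse.1 ha)) (h1'.subset (hab ▸ hb))
    · intro Q hQ
      rcases List.mem_append.1 hQ with hQ | hQ
      · exact hP𝒬 l hl Q (h1.subset (List.mem_reverse.1 hQ))
      · exact hP𝒬 l' hl' Q (h1'.subset hQ)
    · refine List.IsChain.append ?_ ((hPc l' hl').2.suffix h1') ?_
      · rw [List.isChain_reverse]
        exact ((hPc l hl).2.suffix h1).imp fun _ _ h => h.symm
      · simpa using hlink
  -- the blue copy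
  obtain ⟨Z, hZ, hZc⟩ := Finset.exists_subset_card_eq hunabs
  -- Avoiding `T` makes all edges to `Z` blue. Edges inside `Z` do not matter, since `Z` hosts the
  -- single colour class `c₀`.
  set T := Finset.univ.filter fun w => w ∈ Z ∨ ∃ v ∈ Z, R.Adj v w with hT
  have hTq : ∀ l ∈ P, (q l ∩ T).card ≤ 3 * k * h := by
    intro l hl
    have hq𝒬 := hP𝒬 l hl _ (hqmem l hl)
    have hsub : q l ∩ T ⊆ Z.biUnion fun v => (q l).filter (R.Adj v) := by
      intro w hw
      rw [Finset.mem_inter, hT, Finset.mem_filter] at hw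
      rcases hw.2.2 with hwZ | ⟨v, hv, hvw⟩
      · exact absurd hw.1 (hLQ w (Finset.mem_sdiff.1 (hZ hwZ)).1 _ hq𝒬)
      · exact Finset.mem_biUnion.2 ⟨v, hv, Finset.mem_filter.2 ⟨hw.1, hvw⟩⟩
    calc _ ≤ _ := Finset.card_le_card hsub
      _ ≤ Z.card * (3 * k) := Finset.card_biUnion_le_card_mul _ _ _ fun v hv =>
          (not_le.1 (hemax v (hZ hv) _ hq𝒬 fun a ha hq =>
            (hqm l hl).1 (Finset.mem_image.2 ⟨a, ha, hq⟩))).le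
      _ ≤ h * (3 * k) := Nat.mul_le_mul_right _ (hZc ▸ sigma_le_card H)
      _ = _ := mul_comm _ _
  have hIc : (Finset.univ.erase c₀).card = chi H - 1 := by
    rw [Finset.card_erase_of_mem (Finset.mem_univ _), Finset.card_univ, Fintype.card_fin]
  obtain ⟨Y, hY, hYd⟩ := exists_family_of_list (R := R) (k := k) hk hh1
    (I := Finset.univ.erase c₀) (D := P.map q) (T := T) (by
      rw [List.pairwise_map]
      refine hPnd.2.imp_of_mem fun {l l'} hl hl' hd => ?_
      exact ⟨hunl l hl l' hl' hd, hheads_disj hl hl' hd (hqmem l hl) (hqmem l' hl')⟩) (by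
      intro Q hQ
      obtain ⟨l, hl, rfl⟩ := List.mem_map.1 hQ
      exact ⟨(hQc _ (hP𝒬 l hl _ (hqmem l hl))).2, hTq l hl⟩) (by omega) (by
      rw [List.length_map]; omega)
  have hcross : ∀ d, d ≠ c₀ → ∀ a ∈ Z, ∀ b ∈ Y d, a ≠ b ∧ ¬ R.Adj a b := by
    intro d hd a ha b hb
    have hbT := Finset.disjoint_left.1 (hY d (by simp [hd])).1 hb
    simp only [hT, Finset.mem_filter, Finset.mem_univ, true_and, not_or, not_exists, not_and]
      at hbT
    exact ⟨fun h => hbT.1 (h ▸ ha), hbT.2 a ha⟩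
  refine hblue (isContained_compl_of_family Cl (Y := fun c => if c = c₀ then Z else Y c) ?_ ?_)
  · intro c
    by_cases hc : c = c₀
    · subst hc
      simpa [hZc] using hc₀.ge
    · simpa [hc, (hY c (by simp [hc])).2] using hclass c
  · intro c d hcd a ha b hb
    by_cases hc : c = c₀ <;> by_cases hd : d = c₀
    · exact absurd (hc.trans hd.symm) hcd
    · simp only [hc, hd, if_true, if_false] at ha hb
      exact hcross d hd a ha b hb
    · simp only [hc, hd, if_true, if_false] at ha hb
      have := hcross c hc b hb a ha
      exact ⟨this.1.symm, fun h => this.2 h.symm⟩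
    · simp only [hc, hd, if_false] at ha hb
      exact hYd c (by simp [hc]) d (by simp [hd]) hcd a ha b hb

end Upper

/-! ### The lower bound -/

section Lower

/-- A colouring with exactly χ(H) colours uses all of them. -/
theorem sigma_pos {W : Type*} [Fintype W] [Nonempty W] (H : SimpleGraph W) : 0 < sigma H := by
  obtain ⟨C, c, h⟩ := exists_coloring_sigma H
  have hchi : H.chromaticNumber = (chi H : ℕ∞) :=
    (ENat.natCast_toNat (chromaticNumber_ne_top_iff_exists.2 ⟨_, colorable_chi H⟩)).symm
  obtain ⟨w, hw⟩ := (chromaticNumber_eq_iff_forall_surjective (colorable_chi H)).1 hchi C c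
  rw [h, Set.ncard_pos (Set.toFinite _)]
  exact ⟨w, hw⟩

theorem card_le_of_forall_mem_Ico {N a b : ℕ} {S : Set (Fin N)}
    (h : ∀ v ∈ S, a ≤ (v : ℕ) ∧ (v : ℕ) < b) : S.ncard ≤ b - a := by
  have h1 : (Fin.val '' S).ncard = S.ncard := Set.ncard_image_of_injective _ Fin.val_injective
  have h2 : Fin.val '' S ⊆ (Finset.Ico a b : Set ℕ) := by
    rintro _ ⟨v, hv, rfl⟩
    simpa using h v hv
  rw [← h1, ← Nat.card_Ico, ← Set.ncard_coe_finset]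
  exact Set.ncard_le_ncard h2 (Finset.finite_toSet _)

/-- Red edges inside colour classes, blue edges between them. -/
def classGraph {X Y : Type*} (c : X → Y) : SimpleGraph X where
  Adj u v := u ≠ v ∧ c u = c v
  symm := ⟨fun _ _ h => ⟨h.1.symm, h.2.symm⟩⟩
  loopless := ⟨fun _ h => h.1 rfl⟩

theorem le_ncard_of_isContained_classGraph {V X Y : Type*} [Fintype V] [Finite X]
    {G : SimpleGraph V} {c : X → Y} (hG : G.Connected) (h : G.IsContained (classGraph c)) :
    ∃ y, Fintype.card V ≤ {x | c x = y}.ncard := by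
  obtain ⟨f⟩ := h
  obtain ⟨v₀⟩ := hG.nonempty
  have hwalk : ∀ {u v : V}, G.Walk u v → c (f u) = c (f v) := by
    intro u v p
    induction p with
    | nil => rfl
    | cons hadj p ih => exact (f.toHom.map_adj hadj).2.trans ih
  refine ⟨c (f v₀), ?_⟩
  rw [← Nat.card_eq_fintype_card, ← Set.ncard_univ, ← Set.ncard_image_of_injective _ f.injective]
  refine Set.ncard_le_ncard ?_ (Set.toFinite _)
  rintro _ ⟨v, -, rfl⟩
  obtain ⟨p⟩ := hG.preconnected v v₀
  exact hwalk p

theorem exists_sigma_le_of_isContained_compl_classGraph {W X : Type*} [Fintype W] [Finite X]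
    {H : SimpleGraph W} {c : X → Fin (chi H)} (h : H.IsContained (classGraph c)ᶜ)
    (y : Fin (chi H)) : sigma H ≤ {x | c x = y}.ncard := by
  obtain ⟨f⟩ := h
  let C : H.Coloring (Fin (chi H)) := Coloring.mk (fun w => c (f w)) (by
    intro a b hab hc
    have h1 := f.toHom.map_adj hab
    rw [compl_adj] at h1
    exact h1.2 ⟨h1.1, hc⟩)
  refine (sigma_le_ncard C y).trans ?_
  rw [← Set.ncard_image_of_injective _ f.injective]
  refine Set.ncard_le_ncard ?_ (Set.toFinite _)
  rintro _ ⟨w, hw, rfl⟩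
  exact hw

theorem ramsey_lower_bound {V W : Type*} [Fintype V] [Fintype W] [Nonempty W] {G : SimpleGraph V}
    (H : SimpleGraph W) (hG : G.Connected) (h2 : 2 ≤ Fintype.card V)
    (hW : Fintype.card W ≤ Fintype.card V) {N : ℕ}
    (hN : ∀ red : SimpleGraph (Fin N), G.IsContained red ∨ H.IsContained redᶜ) :
    (chi H - 1) * (Fintype.card V - 1) + sigma H ≤ N := by
  by_contra! hlt
  have hr := chi_pos H
  have hσ := sigma_pos H
  have hσh := sigma_le_card H
  obtain ⟨n, hn⟩ : ∃ n, Fintype.card V = n + 1 := ⟨Fintype.card V - 1, by omega⟩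
  rw [hn, Nat.add_sub_cancel] at hlt
  obtain ⟨r, hr'⟩ : ∃ r, chi H = r + 1 := ⟨chi H - 1, by omega⟩
  rw [hr', Nat.add_sub_cancel] at hlt
  have hn0 : 0 < n := by omega
  -- Here `n` is |G|-1: consecutive intervals of length `n`, with everything from r·n on in the last
  -- class.
  let c : Fin N → Fin (chi H) := fun v => ⟨min (v / n) r, by omega⟩
  have hlast : {x | c x = ⟨r, by omega⟩}.ncard ≤ N - r * n := by
    refine card_le_of_forall_mem_Ico fun v hv => ⟨?_, v.2⟩
    have hv' : min ((v : ℕ) / n) r = r := congrArg Fin.val hv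
    rw [← Nat.le_div_iff_mul_le hn0]
    omega
  rcases hN (classGraph c) with h | h
  · obtain ⟨y, hy⟩ := le_ncard_of_isContained_classGraph hG h
    by_cases hyr : (y : ℕ) = r
    · have : y = ⟨r, by omega⟩ := Fin.ext hyr
      rw [this] at hy
      omega
    · have hyc : {x | c x = y}.ncard ≤ (y + 1) * n - y * n := by
        refine card_le_of_forall_mem_Ico fun v hv => ?_
        have hv' : min ((v : ℕ) / n) r = y := congrArg Fin.val hv
        have hv2 : (v : ℕ) / n = y := by omega
        rw [← Nat.le_div_iff_mul_le hn0, ← Nat.div_lt_iff_lt_mul hn0]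
        omega
      rw [add_mul, one_mul, Nat.add_sub_cancel_left] at hyc
      omega
  · have := exists_sigma_le_of_isContained_compl_classGraph h ⟨r, by omega⟩
    omega

end Lower

/-! ### The Ramsey number and bounded bandwidth -/

section Ramsey

theorem cliqueSize_bound {k h n : ℕ} (hk : 1 ≤ k) (hh : 1 ≤ h)
    (hn : (20 * k * h) ^ (16 * k * h) ≤ n) :
    4 * cliqueSize k h ^ h * cliqueSize k h ≤ n ∧ 20 * h ≤ n := by
  have hkh : 1 ≤ k * h := Nat.mul_pos hk hh
  have hhk : h ≤ k * h := Nat.le_mul_of_pos_left _ hk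
  have hkk : k ≤ k * h := Nat.le_mul_of_pos_right _ hh
  set M := 20 * k * h with hM
  have hMe : M = 20 * (k * h) := mul_assoc _ _ _
  have hM1 : 1 ≤ M := by omega
  have he : 16 * k * h = 16 * (k * h) := mul_assoc _ _ _
  have hp : probeSize k h ≤ M ^ 3 := by
    have : M ^ 3 = 8000 * (k ^ 3 * h ^ 3) := by rw [hM]; ring
    rw [this, probeSize, mul_assoc]
    exact Nat.mul_le_mul (by norm_num) (Nat.mul_le_mul_right _ (Nat.le_self_pow (by norm_num) k))
  have hs : cliqueSize k h ≤ M ^ (6 * k) := by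
    calc cliqueSize k h ≤ (M ^ 3) ^ (k + 1) := Nat.pow_le_pow_left hp _
      _ = M ^ (3 * (k + 1)) := (pow_mul _ _ _).symm
      _ ≤ M ^ (6 * k) := Nat.pow_le_pow_right hM1 (by omega)
  constructor
  · refine le_trans ?_ hn
    calc 4 * cliqueSize k h ^ h * cliqueSize k h = 4 * cliqueSize k h ^ (h + 1) := by ring
      _ ≤ M * (M ^ (6 * k)) ^ (h + 1) := Nat.mul_le_mul (by omega) (Nat.pow_le_pow_left hs _)
      -- As k and 1 are at most kh, this exponent is at most 13kh.
      _ = M ^ (6 * (k * h) + 6 * k + 1) := by rw [← pow_mul, ← pow_succ']; congr 1; ring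
      _ ≤ M ^ (16 * k * h) := Nat.pow_le_pow_right hM1 (by omega)
  · calc 20 * h ≤ M := by omega
      _ ≤ M ^ (16 * k * h) := Nat.le_self_pow (by omega) _
      _ ≤ n := hn

theorem ramseyNumber_eq_of_isContained_pathPower {V W : Type*} [Fintype V] [Fintype W] [Nonempty W]
    {G : SimpleGraph V} (H : SimpleGraph W) {k : ℕ} (hk : 1 ≤ k) (hG : G.Connected)
    (hGk : G.IsContained (pathPower (Fintype.card V) k))
    (hn : (20 * k * Fintype.card W) ^ (16 * k * Fintype.card W) ≤ Fintype.card V) :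
    ramseyNumber G H = (chi H - 1) * (Fintype.card V - 1) + sigma H := by
  have hh : 1 ≤ Fintype.card W := Fintype.card_pos
  obtain ⟨h1, h2⟩ := cliqueSize_bound hk hh hn
  refine IsLeast.csInf_eq ⟨fun red => ?_, fun N hN =>
    ramsey_lower_bound H hG (by omega) (by omega) hN⟩
  exact (pathPower_or_isContained red H hk h1 (by simp)).imp_left hGk.trans

theorem pathPower_mono {n k k' : ℕ} (h : k ≤ k') : pathPower n k ≤ pathPower n k' :=
  fun _ _ hab => ⟨hab.1, hab.2.trans (by exact_mod_cast h)⟩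

theorem pathGraph_le_pathPower {n k : ℕ} (hk : 1 ≤ k) : pathGraph n ≤ pathPower n k :=
  fun _ _ hab => ⟨hab.ne, (edist_eq_one_iff_adj.2 hab).le.trans (by exact_mod_cast hk)⟩

theorem pathPower_connected {n k : ℕ} (hn : 1 ≤ n) (hk : 1 ≤ k) : (pathPower n k).Connected := by
  obtain ⟨m, rfl⟩ : ∃ m, n = m + 1 := ⟨n - 1, by omega⟩
  exact (pathGraph_connected m).mono (pathGraph_le_pathPower hk)

theorem isContained_pathPower_bandwidth {V : Type*} [Fintype V] (G : SimpleGraph V) :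
    G.IsContained (pathPower (Fintype.card V) (bandwidth G)) := by
  refine Nat.sInf_mem (s := {k : ℕ | G.IsContained (pathPower (Fintype.card V) k)})
    ⟨Fintype.card V, ?_⟩
  let e := Fintype.equivFin V
  refine ⟨⟨⟨e, fun {a b} hab => ⟨fun h => hab.ne (e.injective h), ?_⟩⟩, e.injective⟩⟩
  obtain ⟨p, hp⟩ := (pathGraph_preconnected (Fintype.card V) (e a) (e b)).exists_isPath
  have h1 := hp.length_lt
  rw [Fintype.card_fin] at h1
  exact (edist_le p).trans (by exact_mod_cast h1.le)

/-- With x = log n, the bound reads 20kh · log x ≤ x. As log x ≥ 1 it gives 20kh ≤ x, hence 16kh ·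
log(20kh) ≤ 16kh · log x ≤ x. -/
theorem pow_le_of_le_log_div {k h n : ℕ} (hk : 1 ≤ k) (hh : 1 ≤ h)
    (hL : 1 ≤ Real.log (Real.log n)) (hx : 0 < Real.log n) (hn : 0 < n)
    (hle : (k : ℝ) ≤ 1 / (20 * h) * (Real.log n / Real.log (Real.log n))) :
    (20 * k * h) ^ (16 * k * h) ≤ n := by
  have hk' : (1 : ℝ) ≤ k := by exact_mod_cast hk
  have hh' : (1 : ℝ) ≤ h := by exact_mod_cast hh
  have hn' : (0 : ℝ) < n := by exact_mod_cast hn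
  have hpos : (0 : ℝ) < 20 * k * h := by positivity
  set x := Real.log n
  set l := Real.log x
  have h1 : 20 * k * h * l ≤ x := by
    have h2 : 1 / (20 * h) * (x / l) = x / (20 * h * l) := by
      field_simp
    rw [h2, le_div_iff₀ (by positivity)] at hle
    linarith
  have h3 : (20 * k * h : ℝ) ≤ x := le_trans (le_mul_of_one_le_right hpos.le hL) h1
  have h4 : Real.log (20 * k * h) ≤ l := Real.log_le_log hpos h3
  have h5 : Real.log (((20 * k * h : ℝ)) ^ (16 * k * h)) ≤ x := by
    rw [Real.log_pow]
    push_cast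
    have : (16 * k * h : ℝ) * Real.log (20 * k * h) ≤ 16 * k * h * l :=
      mul_le_mul_of_nonneg_left h4 (by positivity)
    have h6 : 0 ≤ (k * h : ℝ) * l := by positivity
    linarith
  have h7 := (Real.log_le_log_iff (by positivity) hn').1 h5
  exact_mod_cast h7

theorem boundedBandwidth_alwaysGood (κ : ℕ → ℝ)
    (hκ : κ =o[atTop] (fun n : ℕ => Real.log (n : ℝ) / Real.log (Real.log (n : ℝ)))) :
    GraphClass.AlwaysGood (boundedBandwidth.{u} κ) := by
  intro W _ _ H
  set h := Fintype.card W with hh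
  have hh1 : 1 ≤ h := Fintype.card_pos
  have hlog : Tendsto (fun n : ℕ => Real.log (n : ℝ)) atTop atTop :=
    Real.tendsto_log_atTop.comp tendsto_natCast_atTop_atTop
  have hε : (0 : ℝ) < 1 / (20 * h) := by
    have : (0 : ℝ) < h := by exact_mod_cast hh1
    positivity
  have hev := (((hκ.bound hε).and (hlog.eventually_gt_atTop 0)).and
    ((Real.tendsto_log_atTop.comp hlog).eventually_ge_atTop 1)).and
    (eventually_ge_atTop ((20 * 1 * h) ^ (16 * 1 * h)))
  obtain ⟨n₀, hn₀⟩ := eventually_atTop.1 hev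
  refine ⟨n₀, fun V _ G hG hV => ⟨hG.2, ?_⟩⟩
  obtain ⟨⟨⟨h1, h2⟩, h3⟩, h4⟩ := hn₀ _ hV
  have hV1 : 0 < Fintype.card V := lt_of_lt_of_le (by positivity) h4
  -- The maximum with 1 covers bandwidth 0, where k ≥ 1 would fail.
  refine ramseyNumber_eq_of_isContained_pathPower H (le_max_right (bandwidth G) 1) hG.2
    ((isContained_pathPower_bandwidth G).trans
      (IsContained.of_le (pathPower_mono (le_max_left _ _)))) ?_
  rcases le_total (bandwidth G) 1 with hb | hb
  · rw [max_eq_right hb]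
    exact h4
  · rw [max_eq_left hb]
    refine pow_le_of_le_log_div hb hh1 h3 h2 hV1 (hG.1.trans ((le_abs_self _).trans ?_))
    rw [Function.comp_apply] at h3
    rw [Real.norm_eq_abs, Real.norm_eq_abs, abs_of_nonneg (a := _ / _)
      (div_nonneg h2.le (zero_le_one.trans h3))] at h1
    exact h1

end Ramsey

theorem mainTheorem1 :
    (∀ (W : Type u) [Fintype W] [Nonempty W] (H : SimpleGraph W) (k : ℕ), 1 ≤ k →
      ∀ n : ℕ, (20 * k * Fintype.card W) ^ (16 * k * Fintype.card W) ≤ n →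
        ramseyNumber (pathPower n k) H = (chi H - 1) * (n - 1) + sigma H) ∧
    (∀ κ : ℕ → ℝ,
      κ =o[atTop] (fun n : ℕ => Real.log (n : ℝ) / Real.log (Real.log (n : ℝ))) →
        GraphClass.AlwaysGood (boundedBandwidth.{u} κ)) := by
  refine ⟨fun W _ _ H k hk n hn => ?_, boundedBandwidth_alwaysGood⟩
  have hn1 : 1 ≤ n := by
    have := (cliqueSize_bound hk Fintype.card_pos hn).2
    have : 0 < Fintype.card W := Fintype.card_pos
    omega
  simpa using ramseyNumber_eq_of_isContained_pathPower H hk (pathPower_connected hn1 hk)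
    (by rw [Fintype.card_fin]; exact .rfl) (by simpa using hn)
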